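/- Let $\mathsf T$ be an open subset of a Hilbert scheme of subschemes of $\mathbb P^N$ over $\mathbb C$ (only its underlying analytic variety is used), all of whose points $t$ are smooth projective varieties $X_t\subset\mathbb P^N$ of some dimension $r$ (for instance $r=3$). Let $\mathsf S\subset\mathbb P(\mathbb C[x,y]_d^{N+1})$ be the set of tuples $[f_0:\dots:f_N]$ of binary forms of degree $d$ that are not in $\mathbb C[x,y]_d\cdot\mathbb C^{N+1}$ and have no common zero in $\mathbb P^1$; such a tuple gives the map $f:\mathbb P^1\to\mathbb P^N$, $[x:y]\mapsto[f_0(x,y):\dots:f_N(x,y)]$, and the rational curve $Z_f=f(\mathbb P^1)$, regarded as an algebraic cycle with homology class $f_*[\mathbb P^1]$, where $[\mathbb P^1]$ is a generator of $H_2(\mathbb P^1,\mathbb Z)$. Let $\tilde{\mathsf W}$ be an irreducible component of the incidence variety $\mathsf W=\{(t,f)\in\mathsf T\times\mathsf S : Z_f\subset X_t\}$, with projection $\pi:\tilde{\mathsf W}\to\mathsf T$ and image $\tilde{\mathsf V}=\pi(\tilde{\mathsf W})$. Let $p$ be a smooth point of $\tilde{\mathsf W}$ such that $\pi(p)$ is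 a smooth point of $\tilde{\mathsf V}$, and let $(t,s)$, with $t$ in a polydisc $D\subset\mathbb C^n$ and $s$ in a polydisc $D'\subset\mathbb C^m$, both centred at $0$, be holomorphic coordinates on a neighbourhood of $p$ in $\tilde{\mathsf W}$, and $t$ holomorphic coordinates on a neighbourhood of $\pi(p)$ in $\tilde{\mathsf V}$, such that $\pi(t,s)=t$. Write $f_{t,s}$ for the corresponding maps and $Z_{t,s}=f_{t,s}(\mathbb P^1)\subset X_t$. Let $L\subset\mathbb C^m$ be a linear subspace (for instance $L=\mathbb C^m$). Then: 1. For all $t\in D$ and $s_1,s_2\in D'\cap L$, the classes of $Z_{t,s_1}$ and $Z_{t,s_2}$ in $H_2(X_t,\mathbb Z)$ are equal. Moreover the homology between them can be supported in the family: there are singular $2$-cycles $z_i$ in $Z_{t,s_i}$ representing $(f_{t,s_i})_*[\mathbb P^1]\in H_2(Z_{t,s_i},\mathbb Z)$, $i=1,2$, and a singular $3$-chain $\delta_t$ in $\bigcup_{s\in D'\cap L}Z_{t,s}\subset X_t$ with $\partial\delta_t=z_2-z_1$. 2. For all $s\in D'$, all $t_1,t_2\in D$ and every path in $D$ from $t_1$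 to $t_2$, the monodromy map $H_2(X_{t_1},\mathbb Z)\to H_2(X_{t_2},\mathbb Z)$ along the path (transport by a trivialization of the family $X_t$ over the path) sends the class of $Z_{t_1,s}$ to the class of $Z_{t_2,s}$. -/

import Mathlib

open CategoryTheory AlgebraicTopology Topology Filter
open scoped LinearAlgebra.Projectivization

noncomputable section

namespace RatCurves

/-! ### Projective spaces and homogeneous forms -/

/-- The classical (quotient) topology on a complex projective space. -/
instance projTopology (V : Type) [AddCommGroup V] [Module ℂ V] [TopologicalSpace V] :
    TopologicalSpace (ℙ ℂ V) :=
  inferInstanceAs (TopologicalSpace (Quotient (projectivizationSetoid ℂ V)))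

/-- Complex projective space `ℙ^N`. -/
abbrev PN (N : ℕ) : Type := ℙ ℂ (Fin (N + 1) → ℂ)

/-- Homogeneous forms of degree `k` in the `N + 1` variables `x_0, …, x_N`, given by their
coefficients: a finite-dimensional complex vector space, indexed by the monomials of degree `k`
(multisets of `k` variables). -/
abbrev Form (N k : ℕ) : Type := Sym (Fin (N + 1)) k → ℂ

/-- The polynomial with given coefficients. -/
def Form.toPoly {N k : ℕ} : Form N k →ₗ[ℂ] MvPolynomial (Fin (N + 1)) ℂ :=
  Fintype.linearCombination ℂ
    (fun m : Sym (Fin (N + 1)) k => ((m : Multiset (Fin (N + 1))).map MvPolynomial.X).prod)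

/-- The value of a form at a vector. -/
def Form.eval {N k : ℕ} (c : Form N k) (z : Fin (N + 1) → ℂ) : ℂ :=
  MvPolynomial.eval z c.toPoly

theorem Form.eval_eq {N k : ℕ} (c : Form N k) (z : Fin (N + 1) → ℂ) :
    c.eval z = ∑ m, c m * ((m : Multiset (Fin (N + 1))).map z).prod := by
  have h : ∀ s : Multiset (Fin (N + 1)),
      MvPolynomial.eval z ((s.map MvPolynomial.X).prod) = (s.map z).prod := by
    intro s
    rw [map_multiset_prod, Multiset.map_map]
    congr 1
    exact Multiset.map_congr rfl (fun i _ => by simp)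
  simp [Form.eval, Form.toPoly, Fintype.linearCombination_apply, MvPolynomial.smul_eval, h]

theorem Form.eval_smul {N k : ℕ} (c : Form N k) (a : ℂ) (z : Fin (N + 1) → ℂ) :
    c.eval (a • z) = a ^ k * c.eval z := by
  rw [Form.eval_eq, Form.eval_eq, Finset.mul_sum]
  refine Finset.sum_congr rfl fun m _ => ?_
  have : ((m : Multiset (Fin (N + 1))).map (a • z)).prod
      = a ^ k * ((m : Multiset (Fin (N + 1))).map z).prod := by
    have h1 : (a • z) = fun i => a * z i := rfl
    rw [h1, Multiset.prod_map_mul]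
    simp
  rw [this]; ring

theorem Form.smul_eval {N k : ℕ} (c : Form N k) (a : ℂ) (z : Fin (N + 1) → ℂ) :
    (a • c).eval z = a * c.eval z := by
  simp [Form.eval]

theorem Form.continuous_eval {N k : ℕ} (c : Form N k) : Continuous c.eval :=
  MvPolynomial.continuous_eval _

/-! ### The Hilbert scheme as a subset of a Grassmannian -/

/-- The set of all linear subspaces of `V` (the disjoint union of the Grassmannians of `V`). -/
def Grass (V : Type) [AddCommGroup V] [Module ℂ V] : Type := Submodule ℂ V

/-- The linear subspace which a point of the Grassmannian is. -/
def Grass.subspace {V : Type} [AddCommGroup V] [Module ℂ V] (Λ : Grass V) : Submodule ℂ V := Λ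

/-- The classical topology on Grassmannians: the quotient topology from the spaces of linearly
independent `r`-frames, `r = 0, 1, 2, …`. -/
instance grassTopology (V : Type) [AddCommGroup V] [Module ℂ V] [TopologicalSpace V] :
    TopologicalSpace (Grass V) :=
  ⨆ r : ℕ, TopologicalSpace.coinduced
    (fun e : {e : Fin r → V // LinearIndependent ℂ e} =>
      (Submodule.span ℂ (Set.range e.1) : Submodule ℂ V)) inferInstance

/-- The degree `k` part of an ideal of `ℂ[x_0, …, x_N]`. -/
def piece {N : ℕ} (I : Ideal (MvPolynomial (Fin (N + 1)) ℂ)) (k : ℕ) : Submodule ℂ (Form N k) :=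
  (I.restrictScalars ℂ).comap Form.toPoly

/-- `I` is the saturated homogeneous ideal of a closed subscheme of `ℙ^N` with Hilbert
polynomial `P`. -/
structure IsHilbertIdeal {N : ℕ} (P : Polynomial ℚ)
    (I : Ideal (MvPolynomial (Fin (N + 1)) ℂ)) : Prop where
  homogeneous : ∀ f ∈ I, ∀ j, MvPolynomial.homogeneousComponent j f ∈ I
  saturated : ∀ f, (∀ i, MvPolynomial.X i * f ∈ I) → f ∈ I
  hilbert : ∀ᶠ j : ℕ in atTop,
    (Module.finrank ℂ (Form N j ⧸ piece I j) : ℚ) = P.eval (j : ℚ)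

/-- `k` is so large that, in all degrees `j ≥ k`, every closed subscheme of `ℙ^N` with Hilbert
polynomial `P` has Hilbert function `P j` and has its ideal generated by the degree `k` part
(such `k` exist for every `P`, by boundedness of regularity). -/
def IsHilbertBound (N : ℕ) (P : Polynomial ℚ) (k : ℕ) : Prop :=
  ∀ I : Ideal (MvPolynomial (Fin (N + 1)) ℂ), IsHilbertIdeal P I → ∀ j, k ≤ j →
    (Module.finrank ℂ (Form N j ⧸ piece I j) : ℚ) = P.eval (j : ℚ) ∧
    ∀ c ∈ piece I j, Form.toPoly c ∈ Ideal.span (Form.toPoly '' (piece I k : Set (Form N k)))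

/-- The complex points of the Hilbert scheme of closed subschemes of `ℙ^N` with Hilbert
polynomial `P`, with its standard embedding in the Grassmannian of subspaces of the forms of
degree `k`, a subscheme with ideal `I` being sent to the degree `k` part of `I`. -/
def Hilb (N : ℕ) (P : Polynomial ℚ) (k : ℕ) : Set (Grass (Form N k)) :=
  {Λ | ∃ I : Ideal (MvPolynomial (Fin (N + 1)) ℂ), IsHilbertIdeal P I ∧ Λ = piece I k}

/-- The homogeneous ideal `I` defines a smooth projective variety of dimension `r` in `ℙ^N`:
it is prime, and the Jacobian criterion holds at every point of its zero locus. -/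
def IsSmoothVariety {N : ℕ} (r : ℕ) (I : Ideal (MvPolynomial (Fin (N + 1)) ℂ)) : Prop :=
  I.IsPrime ∧ ∀ z : Fin (N + 1) → ℂ, z ≠ 0 → (∀ F ∈ I, MvPolynomial.eval z F = 0) →
    Module.finrank ℂ (Submodule.span ℂ
      ((fun (F : MvPolynomial (Fin (N + 1)) ℂ) (i : Fin (N + 1)) =>
        MvPolynomial.eval z (MvPolynomial.pderiv i F)) '' (I : Set _))) + r = N

/-- `T` is an open subset of the Hilbert scheme, all of whose points are smooth projective
varieties of dimension `r`. -/
structure IsSmoothHilbertOpen {N : ℕ} (r : ℕ) (P : Polynomial ℚ) (k : ℕ)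
    (T : Set (Grass (Form N k))) : Prop where
  isOpen : ∃ O : Set (Grass (Form N k)), IsOpen O ∧ T = Hilb N P k ∩ O
  smooth : ∀ Λ ∈ T, ∃ I : Ideal (MvPolynomial (Fin (N + 1)) ℂ),
    IsHilbertIdeal P I ∧ Λ = piece I k ∧ IsSmoothVariety r I

/-- The projective variety `X_Λ ⊆ ℙ^N` belonging to a point `Λ` of the Hilbert scheme. -/
def variety {N k : ℕ} (Λ : Grass (Form N k)) : Set (PN N) :=
  {x | ∀ c ∈ Λ.subspace, Form.eval c x.rep = 0}

/-! ### Parametrized rational curves -/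

/-- The projective space of `(N + 1)`-tuples of binary forms of degree `d`. -/
abbrev Tuples (N d : ℕ) : Type := ℙ ℂ (Fin (N + 1) → Form 1 d)

/-- The parameter space of rational curves of degree `d` in `ℙ^N`: the tuples
`[f_0 : … : f_N]` which are not of the form `g • v` with `g` a binary form and `v` a vector, and
for which `[x : y] ↦ [f_0(x,y) : … : f_N(x,y)]` is a map on `ℙ¹` (no common zeros). -/
def RatParam (N d : ℕ) : Set (Tuples N d) :=
  {F | (¬ ∃ (g : Form 1 d) (v : Fin (N + 1) → ℂ), F.rep = fun i => v i • g) ∧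
    ∀ z : Fin 2 → ℂ, z ≠ 0 → (fun i => (F.rep i).eval z) ≠ 0}

/-- The map `ℙ¹ → ℙ^N`, `[x : y] ↦ [f_0(x,y) : … : f_N(x,y)]`. -/
def curveFun {N d : ℕ} (F : RatParam N d) (z : PN 1) : PN N :=
  Projectivization.mk ℂ (fun i => (F.1.rep i).eval z.rep) (F.2.2 z.rep z.rep_nonzero)

theorem curveFun_mk {N d : ℕ} (F : RatParam N d) (v : Fin 2 → ℂ) (hv : v ≠ 0) :
    curveFun F (Projectivization.mk ℂ v hv) =
      Projectivization.mk ℂ (fun i => (F.1.rep i).eval v) (F.2.2 v hv) := by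
  obtain ⟨a, ha⟩ := Projectivization.exists_smul_eq_mk_rep ℂ v hv
  rw [curveFun, Projectivization.mk_eq_mk_iff]
  refine ⟨a ^ d, ?_⟩
  funext i
  have h : (Projectivization.mk ℂ v hv).rep = (a : ℂ) • v := ha.symm
  rw [h, Form.eval_smul]
  simp [Units.smul_def]

theorem continuous_curveFun {N d : ℕ} (F : RatParam N d) : Continuous (curveFun F) := by
  have hq : IsQuotientMap (fun v : {v : Fin 2 → ℂ // v ≠ 0} => Projectivization.mk ℂ v.1 v.2) :=
    isQuotientMap_quotient_mk'
  have hq' : Continuous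
      (fun v : {v : Fin (N + 1) → ℂ // v ≠ 0} => Projectivization.mk ℂ v.1 v.2) :=
    continuous_quotient_mk'
  rw [hq.continuous_iff]
  have : (curveFun F ∘ fun v : {v : Fin 2 → ℂ // v ≠ 0} => Projectivization.mk ℂ v.1 v.2) =
      (fun v : {v : Fin (N + 1) → ℂ // v ≠ 0} => Projectivization.mk ℂ v.1 v.2) ∘
      (fun v : {v : Fin 2 → ℂ // v ≠ 0} =>
        ⟨fun i => (F.1.rep i).eval v.1, F.2.2 v.1 v.2⟩) := by
    funext v
    exact curveFun_mk F v.1 v.2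
  rw [this]
  refine hq'.comp (Continuous.subtype_mk (continuous_pi fun i => ?_) _)
  exact (Form.continuous_eval _).comp continuous_subtype_val

/-- The rational curve: the image of `ℙ¹` under the map above. -/
def curve {N d : ℕ} (F : RatParam N d) : Set (PN N) := Set.range (curveFun F)

/-- The parametrization `ℙ¹ → Z` of a rational curve `Z`. -/
def curveMap {N d : ℕ} (F : RatParam N d) : C(PN 1, curve F) where
  toFun z := ⟨curveFun F z, z, rfl⟩
  continuous_toFun := (continuous_curveFun F).subtype_mk _

/-- The incidence variety `{(X, Z) | Z ⊆ X}` over `T`. -/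
def incidence {N k : ℕ} (d : ℕ) (T : Set (Grass (Form N k))) :
    Set (Grass (Form N k) × Tuples N d) :=
  {q | q.1 ∈ T ∧ ∃ h : q.2 ∈ RatParam N d, curve ⟨q.2, h⟩ ⊆ variety q.1}

/-! ### Holomorphic charts and irreducible components -/

section Holomorphic

variable {E : Type} [NormedAddCommGroup E] [NormedSpace ℂ E]
  {V : Type} [NormedAddCommGroup V] [NormedSpace ℂ V]
  {W : Type} [NormedAddCommGroup W] [NormedSpace ℂ W]

/-- `e` is a holomorphic local frame, near `x`, of the family of subspaces `φ`. -/
def IsFrameAt (φ : E → Grass V) (x : E) {r : ℕ} (e : E → Fin r → V) : Prop :=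
  AnalyticAt ℂ e x ∧ ∀ᶠ y in 𝓝 x, LinearIndependent ℂ (e y) ∧
    φ y = Submodule.span ℂ (Set.range (e y))

/-- `g` is a holomorphic local lift, near `x`, of the map `φ` to a projective space. -/
def IsLiftAt (φ : E → ℙ ℂ W) (x : E) (g : E → W) : Prop :=
  AnalyticAt ℂ g x ∧ ∀ᶠ y in 𝓝 x, ∃ h : g y ≠ 0, φ y = Projectivization.mk ℂ (g y) h

/-- A map to Grassmannians is holomorphic at `x`. -/
def GrassHolAt (φ : E → Grass V) (x : E) : Prop :=
  ∃ (r : ℕ) (e : E → Fin r → V), IsFrameAt φ x e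

/-- The differential at `x` of a holomorphic map to Grassmannians, an element of
`Hom(Λ, V / Λ)` with `Λ = φ x`, vanishes on the tangent vector `v`. -/
def GrassKer (φ : E → Grass V) (x v : E) : Prop :=
  ∃ (r : ℕ) (e : E → Fin r → V), IsFrameAt φ x e ∧
    ∀ i, fderiv ℂ e x v i ∈ Submodule.span ℂ (Set.range (e x))

/-- A map to a Grassmannian times a projective space is holomorphic at `x`. -/
def PairHolAt (φ : E → Grass V × ℙ ℂ W) (x : E) : Prop :=
  GrassHolAt (fun y => (φ y).1) x ∧ ∃ g : E → W, IsLiftAt (fun y => (φ y).2) x g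

/-- The differential at `x` of a holomorphic map to a Grassmannian times a projective space
vanishes on the tangent vector `v`. -/
def PairKer (φ : E → Grass V × ℙ ℂ W) (x v : E) : Prop :=
  GrassKer (fun y => (φ y).1) x v ∧ ∃ g : E → W, IsLiftAt (fun y => (φ y).2) x g ∧
    fderiv ℂ g x v ∈ Submodule.span ℂ {g x}

/-- `φ` maps the open set `U` of `E` homeomorphically onto an open subset of `A`. -/
structure IsTopChart {M : Type} [TopologicalSpace M] (A : Set M) (U : Set E) (φ : E → M) :
    Prop where
  isOpen : IsOpen U
  mapsTo : Set.MapsTo φ U A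
  injOn : Set.InjOn φ U
  continuousOn : ContinuousOn φ U
  image_open : ∀ U', U' ⊆ U → IsOpen U' → ∃ O : Set M, IsOpen O ∧ φ '' U' = A ∩ O

/-- `φ` is the inverse of a holomorphic coordinate system on an open subset of `A`, with image
`U`; in particular `A` is a complex submanifold near the points of `φ '' U`. -/
structure IsGrassChart (A : Set (Grass V)) (U : Set E) (φ : E → Grass V) : Prop extends
    IsTopChart A U φ where
  hol : ∀ x ∈ U, GrassHolAt φ x
  immersive : ∀ x ∈ U, ∀ v, GrassKer φ x v → v = 0

/-- `φ` is the inverse of a holomorphic coordinate system on an open subset of `A`, with image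
`U`; in particular `A` is a complex submanifold near the points of `φ '' U`. -/
structure IsPairChart (A : Set (Grass V × ℙ ℂ W)) (U : Set E) (φ : E → Grass V × ℙ ℂ W) :
    Prop extends IsTopChart A U φ where
  hol : ∀ x ∈ U, PairHolAt φ x
  immersive : ∀ x ∈ U, ∀ v, PairKer φ x v → v = 0

/-- The smooth points of an analytic set. -/
def smoothPoints (A : Set (Grass V × ℙ ℂ W)) : Set (Grass V × ℙ ℂ W) :=
  {p | ∃ (q : ℕ) (U : Set (Fin q → ℂ)) (φ : (Fin q → ℂ) → Grass V × ℙ ℂ W),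
    IsPairChart A U φ ∧ p ∈ φ '' U}

/-- The irreducible components of an analytic set: the closures in it of the connected
components of the set of its smooth points. -/
def IsIrredComponent (A C : Set (Grass V × ℙ ℂ W)) : Prop :=
  ∃ p ∈ smoothPoints A, C = A ∩ closure (connectedComponentIn (smoothPoints A) p)

end Holomorphic

/-! ### The local family -/

/-- The polydisc of radius `ε` around the origin of `ℂ^q`. -/
abbrev Disc (q : ℕ) (ε : ℝ) : Set (Fin q → ℂ) := Metric.ball 0 ε

/-- Local coordinates `(t, s)` on a subset `C` of the incidence variety of `T`, centred at a smooth
point of `C` over a smooth point of its projection to `T`, in which the projection is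
`(t, s) ↦ t`. -/
structure LocalFamily {N k : ℕ} (d : ℕ) (T : Set (Grass (Form N k)))
    (C : Set (Grass (Form N k) × Tuples N d)) (n m : ℕ) where
  subset : C ⊆ incidence d T
  /-- the radius in the `t`-coordinates -/
  εt : ℝ
  /-- the radius in the `s`-coordinates -/
  εs : ℝ
  εt_pos : 0 < εt
  εs_pos : 0 < εs
  /-- the coordinates on `C` -/
  φ : (Fin n → ℂ) × (Fin m → ℂ) → Grass (Form N k) × Tuples N d
  /-- the coordinates on the projection of `C` -/
  ψ : (Fin n → ℂ) → Grass (Form N k)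
  chart : IsPairChart C (Disc n εt ×ˢ Disc m εs) φ
  chart_base : IsGrassChart (Prod.fst '' C) (Disc n εt) ψ
  proj : ∀ t ∈ Disc n εt, ∀ s ∈ Disc m εs, (φ (t, s)).1 = ψ t

namespace LocalFamily

variable {N k d n m : ℕ} {T : Set (Grass (Form N k))}
  {C : Set (Grass (Form N k) × Tuples N d)} (𝓕 : LocalFamily d T C n m)

theorem mem_incidence (t : Disc n 𝓕.εt) (s : Disc m 𝓕.εs) :
    𝓕.φ (t.1, s.1) ∈ incidence d T :=
  𝓕.subset (𝓕.chart.mapsTo ⟨t.2, s.2⟩)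

/-- The variety `X_t`. -/
def X (t : Disc n 𝓕.εt) : Set (PN N) := variety (𝓕.ψ t.1)

/-- The tuple of forms of the map `f_{t,s}`. -/
def f (t : Disc n 𝓕.εt) (s : Disc m 𝓕.εs) : RatParam N d :=
  ⟨(𝓕.φ (t.1, s.1)).2, (𝓕.mem_incidence t s).2.choose⟩

/-- The rational curve `Z_{t,s}`, the image of `f_{t,s}`. -/
def Z (t : Disc n 𝓕.εt) (s : Disc m 𝓕.εs) : Set (PN N) := curve (𝓕.f t s)

theorem Z_subset_X (t : Disc n 𝓕.εt) (s : Disc m 𝓕.εs) : 𝓕.Z t s ⊆ 𝓕.X t := by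
  have h : 𝓕.Z t s ⊆ variety (𝓕.φ (t.1, s.1)).1 := (𝓕.mem_incidence t s).2.choose_spec
  rw [𝓕.proj t.1 t.2 s.1 s.2] at h
  exact h

/-- The union of the curves `Z_{t,s}`, where `s` runs through the points of a linear subspace. -/
def sweep (L : Submodule ℂ (Fin m → ℂ)) (t : Disc n 𝓕.εt) : Set (PN N) :=
  ⋃ s ∈ {s : Disc m 𝓕.εs | s.1 ∈ L}, 𝓕.Z t s

theorem Z_subset_sweep (L : Submodule ℂ (Fin m → ℂ)) (t : Disc n 𝓕.εt) (s : Disc m 𝓕.εs)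
    (hs : s.1 ∈ L) : 𝓕.Z t s ⊆ 𝓕.sweep L t :=
  Set.subset_biUnion_of_mem (u := fun s => 𝓕.Z t s) hs

theorem sweep_subset_X (L : Submodule ℂ (Fin m → ℂ)) (t : Disc n 𝓕.εt) :
    𝓕.sweep L t ⊆ 𝓕.X t :=
  Set.iUnion₂_subset fun s _ => 𝓕.Z_subset_X t s

end LocalFamily

/-! ### Singular homology with integer coefficients -/

/-- The singular chain complex `C_*(Y; ℤ)`. -/
abbrev chains (Y : Type) [TopologicalSpace Y] : ChainComplex (ModuleCat.{0} ℤ) ℕ :=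
  ((singularChainComplexFunctor (ModuleCat.{0} ℤ)).obj (ModuleCat.of ℤ ℤ)).obj (TopCat.of Y)

/-- The map induced on singular chains by a continuous map. -/
abbrev chainsMap {Y Y' : Type} [TopologicalSpace Y] [TopologicalSpace Y'] (g : C(Y, Y')) :
    chains Y ⟶ chains Y' :=
  ((singularChainComplexFunctor (ModuleCat.{0} ℤ)).obj (ModuleCat.of ℤ ℤ)).map (TopCat.ofHom g)

/-- Singular homology `H_q(Y; ℤ)`. -/
abbrev H (q : ℕ) (Y : Type) [TopologicalSpace Y] : ModuleCat.{0} ℤ :=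
  ((singularHomologyFunctor (ModuleCat.{0} ℤ) q).obj (ModuleCat.of ℤ ℤ)).obj (TopCat.of Y)

/-- The map induced on singular homology by a continuous map. -/
abbrev hmap (q : ℕ) {Y Y' : Type} [TopologicalSpace Y] [TopologicalSpace Y'] (g : C(Y, Y')) :
    H q Y →ₗ[ℤ] H q Y' :=
  (((singularHomologyFunctor (ModuleCat.{0} ℤ) q).obj (ModuleCat.of ℤ ℤ)).map
    (TopCat.ofHom g)).hom

/-- The singular chain `z` is a cycle with homology class `c`. -/
def Represents {q : ℕ} {Y : Type} [TopologicalSpace Y] (z : (chains Y).X q) (c : H q Y) : Prop :=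
  ∃ w : (chains Y).cycles q,
    ((chains Y).iCycles q).hom w = z ∧ ((chains Y).homologyπ q).hom w = c

/-- `μ` is a fundamental class of `ℙ¹`: a generator of the infinite cyclic group `H_2(ℙ¹; ℤ)`
(one of the two orientation classes). -/
def IsFundamentalClass (μ : H 2 (PN 1)) : Prop := ∀ c : H 2 (PN 1), ∃ a : ℤ, c = a • μ

/-- The class in `H_2(Z; ℤ)` of the algebraic cycle of a parametrized rational curve `Z`, the
push-forward of the fundamental class of `ℙ¹` by the parametrization. -/
def cycleClass {N d : ℕ} (μ : H 2 (PN 1)) (F : RatParam N d) : H 2 (curve F) :=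
  hmap 2 (curveMap F) μ

/-- The class of a parametrized rational curve in the homology of a subset `A` of `ℙ^N` which
contains it. -/
def cycleClassIn {N d : ℕ} (μ : H 2 (PN 1)) (F : RatParam N d) {A : Set (PN N)}
    (h : curve F ⊆ A) : H 2 A :=
  hmap 2 (ContinuousMap.inclusion h) (cycleClass μ F)

/-! ### Monodromy -/

section Monodromy

variable {B M : Type} [TopologicalSpace B] [TopologicalSpace M] (X : B → Set M)
  {b₀ b₁ : B} (γ : Path b₀ b₁)

/-- The total space, over the interval, of the pull-back by the path `γ` of the family of
subspaces `X b ⊆ M`, `b ∈ B`. -/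
def totalSpace : Set (unitInterval × M) := {p | p.2 ∈ X (γ p.1)}

/-- The inclusion of the fibre over a time `u` of the path. -/
def fibreIncl (u : unitInterval) (b : B) (h : γ u = b) : C(X b, totalSpace X γ) where
  toFun x := ⟨(u, x.1), by
    have hx : x.1 ∈ X (γ u) := h.symm ▸ x.2
    exact hx⟩
  continuous_toFun := by fun_prop

/-- A trivialization, with fibre `F`, of the pull-back of the family by the path `γ`. -/
structure PathTrivialization (F : Type) [TopologicalSpace F] where
  /-- the homeomorphism to the product -/
  homeo : totalSpace X γ ≃ₜ unitInterval × F
  fst : ∀ p, (homeo p).1 = p.1.1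

/-- The homeomorphism from the first fibre to the last one along a trivialization, as a continuous
map. -/
def PathTrivialization.transport {X : B → Set M} {γ : Path b₀ b₁} {F : Type} [TopologicalSpace F]
    (Φ : PathTrivialization X γ F) : C(X b₀, X b₁) where
  toFun x := ⟨(Φ.homeo.symm (1, (Φ.homeo (fibreIncl X γ 0 b₀ γ.source x)).2)).1.2, by
    set p := Φ.homeo.symm (1, (Φ.homeo (fibreIncl X γ 0 b₀ γ.source x)).2) with hp
    have h1 : p.1.1 = 1 := by rw [← Φ.fst, hp, Homeomorph.apply_symm_apply]
    have h2 : p.1.2 ∈ X (γ p.1.1) := p.2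
    rwa [h1, γ.target] at h2⟩
  continuous_toFun := by fun_prop

/-- The monodromy along `γ` maps `c₀ ∈ H_q(X_{b₀})` to `c₁ ∈ H_q(X_{b₁})`: the transport of `c₀`
along `γ` by any trivialization of the pulled back family is `c₁`, and `c₀` and `c₁` become equal
in the homology of the total space over `γ`. For a locally trivial family, such as a smooth family
of projective varieties, each of the two conditions says that `c₁` is the image of `c₀` under the
isomorphism `H_q(X_{b₀}) ≅ H_q(X_{b₁})` of parallel transport. -/
structure MonodromyMapsTo {q : ℕ} (c₀ : H q (X b₀)) (c₁ : H q (X b₁)) : Prop where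
  transport : ∀ (F : Type) [TopologicalSpace F] (Φ : PathTrivialization X γ F),
    hmap q Φ.transport c₀ = c₁
  total : hmap q (fibreIncl X γ 0 b₀ γ.source) c₀ = hmap q (fibreIncl X γ 1 b₁ γ.target) c₁

end Monodromy

end RatCurves

end

noncomputable section

namespace RatCurves

/-! ### Joint continuity of the evaluation of rational curves -/

/-! A continuous path of parametrized curves is a homotopy of maps out of `ℙ¹`, and homotopic maps
agree on singular homology.

For the first claim, `D' ∩ L` is convex, so the segment from `s₁` to `s₂` gives a homotopy between
`f_{t,s₁}` and `f_{t,s₂}` inside the union of the curves over `D' ∩ L`. Composing with the inclusion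
into `X_t` makes the classes equal. For the chain, take one cycle representing `μ`: its two
push-forwards are `z₁` and `z₂`, and the chain homotopy applied to it is `δ`
(`exists_d_eq_sub_of_homotopy`).

For the second claim, the maps `f_{γ(u),s}` form a homotopy in the total space over `γ`, from the
first fibre to the last, so the two classes agree there. A trivialization retracts the total space
onto the last fibre, and this retraction turns the equality into the statement about transport
(`MonodromyMapsTo.of_total`).

The analytic input is that the chart is continuous and that `(F, z) ↦ curveFun F z` is jointly
continuous (`continuous_curveFun_uncurry`). -/

/-- The saturation of an open set is the union of its preimages under scalings by units, hence open.
Openness matters because, unlike plain quotient maps, open quotient maps are stable under products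
and under restriction to preimages. -/
theorem isOpenQuotientMap_projMk (V : Type) [AddCommGroup V] [Module ℂ V] [TopologicalSpace V]
    [ContinuousConstSMul ℂ V] :
    IsOpenQuotientMap (fun v : {v : V // v ≠ 0} => Projectivization.mk ℂ v.1 v.2) := by
  refine ⟨Quotient.mk_surjective, continuous_quotient_mk', fun U hU => ?_⟩
  refine (isQuotientMap_quotient_mk' (s := projectivizationSetoid ℂ V)).isOpen_preimage.1 ?_
  have h : (Quotient.mk (projectivizationSetoid ℂ V)) ⁻¹'
      ((fun v : {v : V // v ≠ 0} => Projectivization.mk ℂ v.1 v.2) '' U) =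
      ⋃ a : ℂˣ, (fun v : {v : V // v ≠ 0} =>
        (⟨a • v.1, (smul_ne_zero_iff_ne a).2 v.2⟩ : {v : V // v ≠ 0})) ⁻¹' U := by
    ext v
    simp only [Set.mem_preimage, Set.mem_iUnion]
    constructor
    · rintro ⟨u, hu, huv⟩
      obtain ⟨a, ha⟩ := (Projectivization.mk_eq_mk_iff ℂ u.1 v.1 u.2 v.2).1 huv
      refine ⟨a, ?_⟩
      convert hu
    · rintro ⟨a, ha⟩
      exact ⟨_, ha, (Projectivization.mk_eq_mk_iff ℂ _ v.1 _ v.2).2 ⟨a, rfl⟩⟩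
  exact h ▸ isOpen_iUnion fun a => hU.preimage
    ((continuous_subtype_val.const_smul a).subtype_mk _)

theorem continuous_form_eval {N k : ℕ} {A : Type} [TopologicalSpace A] {c : A → Form N k}
    {z : A → Fin (N + 1) → ℂ} (hc : Continuous c) (hz : Continuous z) :
    Continuous fun a => (c a).eval (z a) := by
  simp only [Form.eval_eq]
  refine continuous_finsetSum _ fun m _ => Continuous.mul (by fun_prop) ?_
  exact continuous_multiset_prod (f := fun i a => z a i) _ fun i _ => by fun_prop

theorem eval_ne_zero_of_mk_mem_ratParam {N d : ℕ} {v : Fin (N + 1) → Form 1 d} {hv : v ≠ 0}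
    (h : Projectivization.mk ℂ v hv ∈ RatParam N d) {w : Fin 2 → ℂ} (hw : w ≠ 0) :
    (fun i => (v i).eval w) ≠ 0 := by
  obtain ⟨a, ha⟩ := Projectivization.exists_smul_eq_mk_rep ℂ v hv
  intro h0
  refine h.2 w hw (funext fun i => ?_)
  rw [← ha]
  have : (v i).eval w = 0 := congrFun h0 i
  simp [Units.smul_def, Form.smul_eval, this]

/-- Rescaling the tuple rescales the value, so the chosen `rep` may be replaced by any
representative. This removes `rep`, a choice with no continuity, from continuity arguments. -/
theorem curveFun_mk_mk {N d : ℕ} {v : Fin (N + 1) → Form 1 d} {hv : v ≠ 0}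
    (h : Projectivization.mk ℂ v hv ∈ RatParam N d) {w : Fin 2 → ℂ} (hw : w ≠ 0) :
    curveFun ⟨Projectivization.mk ℂ v hv, h⟩ (Projectivization.mk ℂ w hw) =
      Projectivization.mk ℂ (fun i => (v i).eval w) (eval_ne_zero_of_mk_mem_ratParam h hw) := by
  rw [curveFun_mk, Projectivization.mk_eq_mk_iff]
  obtain ⟨a, ha⟩ := Projectivization.exists_smul_eq_mk_rep ℂ v hv
  refine ⟨a, funext fun i => ?_⟩
  simp [← ha, Units.smul_def, Form.smul_eval]

/-- Continuity descends along the product of the two open quotient maps from nonzero vectors;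
upstairs the map is polynomial in the coefficients and the point. -/
theorem continuous_curveFun_uncurry {N d : ℕ} :
    Continuous fun p : RatParam N d × PN 1 => curveFun p.1 p.2 := by
  have hq := isOpenQuotientMap_projMk (Fin (N + 1) → Form 1 d)
  have hq₁ : IsOpenQuotientMap ((RatParam N d).restrictPreimage
      fun v : {v : Fin (N + 1) → Form 1 d // v ≠ 0} => Projectivization.mk ℂ v.1 v.2) :=
    ⟨Set.restrictPreimage_surjective _ hq.surjective, hq.continuous.restrictPreimage,
      hq.isOpenMap.restrictPreimage _⟩
  rw [← (hq₁.prodMap (isOpenQuotientMap_projMk (Fin 2 → ℂ))).continuous_comp_iff]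
  have h : Continuous fun p : ((fun v : {v : Fin (N + 1) → Form 1 d // v ≠ 0} =>
      Projectivization.mk ℂ v.1 v.2) ⁻¹' RatParam N d) × {w : Fin 2 → ℂ // w ≠ 0} =>
      (⟨fun i => (p.1.1.1 i).eval p.2.1, eval_ne_zero_of_mk_mem_ratParam p.1.2 p.2.2⟩ :
        {v : Fin (N + 1) → ℂ // v ≠ 0}) :=
    by
      refine Continuous.subtype_mk (continuous_pi fun i => continuous_form_eval ?_ ?_) _
      · exact (continuous_apply i).comp (continuous_subtype_val.comp
          (continuous_subtype_val.comp continuous_fst))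
      · exact continuous_subtype_val.comp continuous_snd
  exact ((isOpenQuotientMap_projMk (Fin (N + 1) → ℂ)).continuous.comp h).congr
    fun p => (curveFun_mk_mk p.1.2 p.2.2).symm

theorem continuous_curveFun_apply {N d : ℕ} {A : Type} [TopologicalSpace A]
    {F : A → RatParam N d} {z : A → PN 1} (hF : Continuous F) (hz : Continuous z) :
    Continuous fun a => curveFun (F a) (z a) :=
  Continuous.comp (g := fun p : RatParam N d × PN 1 => curveFun p.1 p.2)
    (f := fun a => (F a, z a)) continuous_curveFun_uncurry (hF.prodMk hz)

/-! ### Homotopy invariance of singular homology -/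

section Homology

variable {Y Y' Y'' : Type} [TopologicalSpace Y] [TopologicalSpace Y'] [TopologicalSpace Y'']

theorem hmap_comp_apply (q : ℕ) (g : C(Y', Y'')) (f : C(Y, Y')) (c : H q Y) :
    hmap q (g.comp f) c = hmap q g (hmap q f c) := by
  have h := ((singularHomologyFunctor (ModuleCat.{0} ℤ) q).obj (ModuleCat.of ℤ ℤ)).map_comp
    (TopCat.ofHom f) (TopCat.ofHom g)
  exact congrArg (fun φ => φ.hom c) h

theorem hmap_id_apply (q : ℕ) (c : H q Y) : hmap q (ContinuousMap.id Y) c = c := by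
  have h := ((singularHomologyFunctor (ModuleCat.{0} ℤ) q).obj (ModuleCat.of ℤ ℤ)).map_id
    (TopCat.of Y)
  exact congrArg (fun φ => φ.hom c) h

theorem hmap_eq_of_homotopy (q : ℕ) {f g : C(Y, Y')} (h : f.Homotopy g) : hmap q f = hmap q g :=
  congrArg ModuleCat.Hom.hom (TopCat.Homotopy.congr_homologyMap_singularChainComplexFunctor
    (f := TopCat.ofHom f) (g := TopCat.ofHom g) h (ModuleCat.of ℤ ℤ) q)

theorem Represents.map {q : ℕ} {z : (chains Y).X q} {c : H q Y} (h : Represents z c)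
    (f : C(Y, Y')) : Represents (((chainsMap f).f q).hom z) (hmap q f c) := by
  obtain ⟨w, rfl, rfl⟩ := h
  exact ⟨(HomologicalComplex.cyclesMap (chainsMap f) q).hom w,
    congrArg (fun φ => φ.hom w) (HomologicalComplex.cyclesMap_i (chainsMap f) q),
    (congrArg (fun φ => φ.hom w)
      (HomologicalComplex.homologyπ_naturality (chainsMap f) q)).symm⟩

theorem exists_represents {q : ℕ} (c : H q Y) : ∃ z, Represents (q := q) z c := by
  obtain ⟨w, hw⟩ := (ModuleCat.epi_iff_surjective ((chains Y).homologyπ q)).1 inferInstance c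
  exact ⟨_, w, rfl, hw⟩

theorem Represents.d_eq_zero {q p : ℕ} {z : (chains Y).X q} {c : H q Y} (h : Represents z c) :
    ((chains Y).d q p).hom z = 0 := by
  obtain ⟨w, rfl, -⟩ := h
  exact congrArg (fun φ => φ.hom w) ((chains Y).iCycles_d q p)

theorem chainsMap_comp_apply {q : ℕ} (g : C(Y', Y'')) (f : C(Y, Y')) (z : (chains Y).X q) :
    ((chainsMap (g.comp f)).f q).hom z = ((chainsMap g).f q).hom (((chainsMap f).f q).hom z) := by
  have h := ((singularChainComplexFunctor (ModuleCat.{0} ℤ)).obj (ModuleCat.of ℤ ℤ)).map_comp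
    (TopCat.ofHom f) (TopCat.ofHom g)
  exact congrArg (fun φ => (φ.f q).hom z) h

/-- Homotopic maps send a cycle to cycles whose difference is a boundary. -/
theorem exists_d_eq_sub_of_homotopy {i j l : ℕ} (hij : i + 1 = j) (hjl : j + 1 = l)
    {f g : C(Y, Y')} (h : f.Homotopy g) {z : (chains Y).X j} {c : H j Y} (hz : Represents z c) :
    ∃ δ : (chains Y').X l, ((chains Y').d l j).hom δ =
      ((chainsMap g).f j).hom z - ((chainsMap f).f j).hom z := by
  subst hij hjl
  -- The homotopy is reversed to fix the sign: a chain homotopy `K` from `g` to `f` satisfies `g =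
  -- Kd + dK + f`, and on a cycle the term `Kd` vanishes.
  let K := TopCat.Homotopy.singularChainComplexFunctorObjMap
    (f := TopCat.ofHom g) (g := TopCat.ofHom f) h.symm (ModuleCat.of ℤ ℤ)
  refine ⟨(K.hom (i + 1) (i + 1 + 1)).hom z, ?_⟩
  have hK := K.comm (i + 1)
  rw [Homotopy.dNext_succ_chainComplex, Homotopy.prevD_chainComplex] at hK
  have hKz := congrArg (fun φ => φ.hom z) hK
  simp only [ModuleCat.hom_add, ModuleCat.hom_comp, LinearMap.add_apply,
    LinearMap.comp_apply] at hKz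
  rw [hz.d_eq_zero, map_zero, zero_add] at hKz
  exact eq_sub_of_add_eq hKz.symm

end Homology

/-! ### Monodromy -/

section Monodromy

variable {B M : Type} [TopologicalSpace B] [TopologicalSpace M] {X : B → Set M}
  {b₀ b₁ : B} {γ : Path b₀ b₁} {F : Type} [TopologicalSpace F]

/-- The retraction of the total space to the last fibre given by a trivialization. -/
def PathTrivialization.toLast (Φ : PathTrivialization X γ F) : C(totalSpace X γ, X b₁) where
  toFun p := ⟨(Φ.homeo.symm (1, (Φ.homeo p).2)).1.2, by
    set p' := Φ.homeo.symm (1, (Φ.homeo p).2) with hp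
    have h1 : p'.1.1 = 1 := by rw [← Φ.fst, hp, Homeomorph.apply_symm_apply]
    have h2 : p'.1.2 ∈ X (γ p'.1.1) := p'.2
    rwa [h1, γ.target] at h2⟩
  continuous_toFun := by fun_prop

/-- On the last fibre the time coordinate is already `1`, so resetting it to `1` changes nothing. -/
theorem PathTrivialization.toLast_comp_fibreIncl_one (Φ : PathTrivialization X γ F) :
    Φ.toLast.comp (fibreIncl X γ 1 b₁ γ.target) = ContinuousMap.id _ := by
  ext x
  have h : ((1 : unitInterval), (Φ.homeo (fibreIncl X γ 1 b₁ γ.target x)).2) =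
      Φ.homeo (fibreIncl X γ 1 b₁ γ.target x) :=
    Prod.ext (Φ.fst (fibreIncl X γ 1 b₁ γ.target x)).symm rfl
  change (Φ.homeo.symm (1, (Φ.homeo (fibreIncl X γ 1 b₁ γ.target x)).2)).1.2 = x.1
  rw [h, Homeomorph.symm_apply_apply]
  rfl

theorem MonodromyMapsTo.of_total {q : ℕ} {c₀ : H q (X b₀)} {c₁ : H q (X b₁)}
    (h : hmap q (fibreIncl X γ 0 b₀ γ.source) c₀ = hmap q (fibreIncl X γ 1 b₁ γ.target) c₁) :
    MonodromyMapsTo X γ c₀ c₁ where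
  transport F _ Φ := by
    -- Transport is by definition the inclusion of the first fibre followed by the retraction to the
    -- last.
    change hmap q (Φ.toLast.comp (fibreIncl X γ 0 b₀ γ.source)) c₀ = c₁
    rw [hmap_comp_apply, h, ← hmap_comp_apply, Φ.toLast_comp_fibreIncl_one, hmap_id_apply]
  total := h

/-- The homotopy at time `u` is `c (γ u)`, placed in the fibre over `u`. -/
theorem homotopic_fibreIncl_comp {Z : Type} [TopologicalSpace Z] {c : ∀ b, C(Z, X b)}
    (hc : Continuous fun p : B × Z => (c p.1 p.2 : M)) (γ : Path b₀ b₁) :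
    ((fibreIncl X γ 0 b₀ γ.source).comp (c b₀)).Homotopic
      ((fibreIncl X γ 1 b₁ γ.target).comp (c b₁)) :=
  ⟨{ toFun := fun p => ⟨(p.1, c (γ p.1) p.2), (c (γ p.1) p.2).2⟩
     continuous_toFun := (continuous_fst.prodMk (hc.comp
      ((γ.continuous.comp continuous_fst).prodMk continuous_snd))).subtype_mk _
     map_zero_left := fun z => Subtype.ext (Prod.ext rfl
      (congrArg (fun b => (c b z : M)) γ.source))
     map_one_left := fun z => Subtype.ext (Prod.ext rfl
      (congrArg (fun b => (c b z : M)) γ.target)) }⟩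

end Monodromy

/-! ### Families of rational curves -/

/-- The parametrization of a rational curve, as a map to a set which contains the curve. -/
def curveMapIn {N d : ℕ} (F : RatParam N d) {A : Set (PN N)} (h : curve F ⊆ A) : C(PN 1, A) :=
  (ContinuousMap.inclusion h).comp (curveMap F)

theorem coe_curveMapIn {N d : ℕ} (F : RatParam N d) {A : Set (PN N)} (h : curve F ⊆ A)
    (z : PN 1) : (curveMapIn F h z : PN N) = curveFun F z :=
  rfl

theorem hmap_curveMapIn {N d : ℕ} (μ : H 2 (PN 1)) (F : RatParam N d) {A : Set (PN N)}
    (h : curve F ⊆ A) : hmap 2 (curveMapIn F h) μ = cycleClassIn μ F h :=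
  hmap_comp_apply 2 _ _ μ

/-- The endpoints enter through equations because the ends of a segment equal the given parameters
only propositionally. -/
theorem homotopic_curveMapIn {N d : ℕ} {A : Set (PN N)} {F : unitInterval → RatParam N d}
    (hF : Continuous F) (hA : ∀ u, curve (F u) ⊆ A) {F₀ F₁ : RatParam N d} (h₀ : F 0 = F₀)
    (h₁ : F 1 = F₁) (hA₀ : curve F₀ ⊆ A) (hA₁ : curve F₁ ⊆ A) :
    (curveMapIn F₀ hA₀).Homotopic (curveMapIn F₁ hA₁) := by
  subst h₀ h₁
  exact ⟨{ toFun := fun p => ⟨curveFun (F p.1) p.2, hA p.1 ⟨p.2, rfl⟩⟩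
           continuous_toFun := (continuous_curveFun_apply (hF.comp continuous_fst)
            continuous_snd).subtype_mk _
           map_zero_left := fun _ => rfl
           map_one_left := fun _ => rfl }⟩

theorem homotopic_fibreIncl_comp_curveMapIn {N d : ℕ} {B : Type} [TopologicalSpace B]
    {X : B → Set (PN N)} {F : B → RatParam N d} (hF : Continuous F)
    (hX : ∀ b, curve (F b) ⊆ X b) {b₀ b₁ : B} (γ : Path b₀ b₁) :
    ((fibreIncl X γ 0 b₀ γ.source).comp (curveMapIn (F b₀) (hX b₀))).Homotopic
      ((fibreIncl X γ 1 b₁ γ.target).comp (curveMapIn (F b₁) (hX b₁))) := by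
  have h : Continuous fun p : B × PN 1 => curveFun (F p.1) p.2 :=
    continuous_curveFun_apply (hF.comp continuous_fst) continuous_snd
  have h' : Continuous fun p : B × PN 1 => (curveMapIn (F p.1) (hX p.1) p.2 : PN N) := by
    simpa only [coe_curveMapIn] using h
  exact homotopic_fibreIncl_comp (c := fun b => curveMapIn (F b) (hX b)) h' γ

theorem hmap_fibreIncl_cycleClassIn {N d : ℕ} (μ : H 2 (PN 1)) {B : Type} [TopologicalSpace B]
    {X : B → Set (PN N)} {F : B → RatParam N d} (hF : Continuous F)
    (hX : ∀ b, curve (F b) ⊆ X b) {b₀ b₁ : B} (γ : Path b₀ b₁) :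
    hmap 2 (fibreIncl X γ 0 b₀ γ.source) (cycleClassIn μ (F b₀) (hX b₀)) =
      hmap 2 (fibreIncl X γ 1 b₁ γ.target) (cycleClassIn μ (F b₁) (hX b₁)) := by
  obtain ⟨h⟩ := homotopic_fibreIncl_comp_curveMapIn hF hX γ
  rw [← hmap_curveMapIn, ← hmap_curveMapIn, ← hmap_comp_apply, ← hmap_comp_apply,
    hmap_eq_of_homotopy 2 h]

namespace LocalFamily

variable {N k d n m : ℕ} {T : Set (Grass (Form N k))}
  {C : Set (Grass (Form N k) × Tuples N d)} (𝓕 : LocalFamily d T C n m)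

theorem continuous_f {A : Type} [TopologicalSpace A] {t : A → Disc n 𝓕.εt}
    {s : A → Disc m 𝓕.εs} (ht : Continuous t) (hs : Continuous s) :
    Continuous fun a => 𝓕.f (t a) (s a) := by
  have h : Continuous fun a => 𝓕.φ ((t a).1, (s a).1) :=
    𝓕.chart.continuousOn.comp_continuous
      ((continuous_subtype_val.comp ht).prodMk (continuous_subtype_val.comp hs))
      fun a => ⟨(t a).2, (s a).2⟩
  exact Continuous.subtype_mk (continuous_snd.comp h) _

/-- The parametrizations of two curves in a fibre are homotopic in the union of the curves over
the segment which joins their parameters. -/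
theorem homotopic_sweep (L : Submodule ℂ (Fin m → ℂ)) (t : Disc n 𝓕.εt) {s₁ s₂ : Disc m 𝓕.εs}
    (h₁ : s₁.1 ∈ L) (h₂ : s₂.1 ∈ L) :
    (curveMapIn (𝓕.f t s₁) (𝓕.Z_subset_sweep L t s₁ h₁)).Homotopic
      (curveMapIn (𝓕.f t s₂) (𝓕.Z_subset_sweep L t s₂ h₂)) := by
  have hmem : ∀ u : unitInterval, AffineMap.lineMap s₁.1 s₂.1 (u : ℝ) ∈ Disc m 𝓕.εs := fun u =>
    (convex_ball (0 : Fin m → ℂ) 𝓕.εs).lineMap_mem s₁.2 s₂.2 u.2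
  have hL : ∀ u : unitInterval, AffineMap.lineMap s₁.1 s₂.1 (u : ℝ) ∈ L := fun u =>
    (L.restrictScalars ℝ).convex.lineMap_mem h₁ h₂ u.2
  have hs : Continuous fun u : unitInterval =>
      (⟨AffineMap.lineMap s₁.1 s₂.1 (u : ℝ), hmem u⟩ : Disc m 𝓕.εs) :=
    (AffineMap.lineMap_continuous.comp continuous_subtype_val).subtype_mk _
  refine homotopic_curveMapIn (𝓕.continuous_f continuous_const hs)
    (fun u => 𝓕.Z_subset_sweep L t _ (hL u)) (congrArg (𝓕.f t) (Subtype.ext ?_))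
    (congrArg (𝓕.f t) (Subtype.ext ?_)) _ _
  · exact AffineMap.lineMap_apply_zero _ _
  · exact AffineMap.lineMap_apply_one _ _

end LocalFamily

end RatCurves

end

open RatCurves in
theorem proposition1 (N d r k : ℕ) (P : Polynomial ℚ) (_hk : IsHilbertBound N P k)
    (T : Set (Grass (Form N k))) (_hT : IsSmoothHilbertOpen r P k T)
    (C : Set (Grass (Form N k) × Tuples N d)) (_hC : IsIrredComponent (incidence d T) C)
    (n m : ℕ) (𝓕 : LocalFamily d T C n m) (L : Submodule ℂ (Fin m → ℂ))
    (μ : H 2 (PN 1)) (_hμ : IsFundamentalClass μ) :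
    (∀ (t : Disc n 𝓕.εt) (s₁ s₂ : Disc m 𝓕.εs) (h₁ : s₁.1 ∈ L) (h₂ : s₂.1 ∈ L),
      cycleClassIn μ (𝓕.f t s₁) (𝓕.Z_subset_X t s₁) =
        cycleClassIn μ (𝓕.f t s₂) (𝓕.Z_subset_X t s₂) ∧
      ∃ (z₁ : (chains (𝓕.Z t s₁)).X 2) (z₂ : (chains (𝓕.Z t s₂)).X 2)
        (δ : (chains (𝓕.sweep L t)).X 3),
        Represents z₁ (cycleClass μ (𝓕.f t s₁)) ∧
        Represents z₂ (cycleClass μ (𝓕.f t s₂)) ∧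
        ((chains (𝓕.sweep L t)).d 3 2).hom δ =
          ((chainsMap (ContinuousMap.inclusion (𝓕.Z_subset_sweep L t s₂ h₂))).f 2).hom z₂ -
          ((chainsMap (ContinuousMap.inclusion (𝓕.Z_subset_sweep L t s₁ h₁))).f 2).hom z₁) ∧
    (∀ (s : Disc m 𝓕.εs) (t₁ t₂ : Disc n 𝓕.εt) (γ : Path t₁ t₂),
      MonodromyMapsTo 𝓕.X γ
        (cycleClassIn μ (𝓕.f t₁ s) (𝓕.Z_subset_X t₁ s))
        (cycleClassIn μ (𝓕.f t₂ s) (𝓕.Z_subset_X t₂ s))) := by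
  refine ⟨fun t s₁ s₂ h₁ h₂ => ?_, fun s t₁ t₂ γ => .of_total ?_⟩
  · obtain ⟨h⟩ := 𝓕.homotopic_sweep L t h₁ h₂
    refine ⟨?_, ?_⟩
    · have key := DFunLike.congr_fun (hmap_eq_of_homotopy 2
        ((ContinuousMap.Homotopy.refl
          (ContinuousMap.inclusion (𝓕.sweep_subset_X L t))).comp h)) μ
      exact (hmap_curveMapIn μ _ _).symm.trans (key.trans (hmap_curveMapIn μ _ _))
    -- The same `z` must serve both curves, since the chain homotopy compares two images of one
    -- cycle.
    · obtain ⟨z, hz⟩ := exists_represents μ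
      obtain ⟨δ, hδ⟩ := exists_d_eq_sub_of_homotopy (i := 1) (l := 3) rfl rfl h hz
      refine ⟨_, _, δ, hz.map (curveMap _), hz.map (curveMap _), hδ.trans ?_⟩
      exact congrArg₂ (· - ·) (chainsMap_comp_apply _ _ z) (chainsMap_comp_apply _ _ z)
  · exact hmap_fibreIncl_cycleClassIn μ (F := fun t => 𝓕.f t s)
      (𝓕.continuous_f continuous_id continuous_const) (fun t => 𝓕.Z_subset_X t s) γ
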